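/- For $n\in\mathbb N=\{0,1,2,\dots\}$ let $\mathbb S^n=\{x\in\mathbb R^{n+1}:\|x\|=1\}$ be the Euclidean unit sphere with the chordal distance $\|x-y\|$ inherited from $\mathbb R^{n+1}$. Let $\mathcal W_2(\mathbb S^n,\|\cdot\|)$ be the set of all Borel probability measures on $\mathbb S^n$ (their second moments are automatically finite, because $\mathbb S^n$ is bounded) with the quadratic Wasserstein distance $$d_{\mathcal W_2}(\mu,\nu)=\Big(\inf_{\pi\in\Pi(\mu,\nu)}\iint_{\mathbb S^n\times\mathbb S^n}\|x-y\|^2\,d\pi(x,y)\Big)^{1/2},$$ where $\Pi(\mu,\nu)$ is the set of couplings of $\mu$ and $\nu$, that is, of Borel probability measures on $\mathbb S^n\times\mathbb S^n$ with first marginal $\mu$ and second marginal $\nu$. An isometry of a metric space is a surjective distance-preserving map of the space onto itself. Theorem. For every $n\in\mathbb N$ the space $\mathcal W_2(\mathbb S^n,\|\cdot\|)$ is isometrically rigid. That is, for every isometry $\Psi$ of $\mathcal W_2(\mathbb S^n,\|\cdot\|)$ there exists an isometry $\psi$ of $(\mathbb S^n,\|\cdot\|)$ such that $\Psi=\psi_\#$,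 i.e. $\Psi(\mu)(A)=\mu(\psi^{-1}[A])$ for every Borel probability measure $\mu$ on $\mathbb S^n$ and every Borel set $A\subseteq\mathbb S^n$. -/

import Mathlib

open MeasureTheory Set
open scoped ENNReal

noncomputable section

/-- The set `Π(μ, ν)` of couplings of `μ` and `ν`: the probability measures on `Y × Y` whose first
and second marginals are `μ` and `ν`. -/
def couplings {Y : Type*} [MeasurableSpace Y] (μ ν : ProbabilityMeasure Y) :
    Set (ProbabilityMeasure (Y × Y)) :=
  {π | (π : Measure (Y × Y)).fst = (μ : Measure Y) ∧ (π : Measure (Y × Y)).snd = (ν : Measure Y)}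

/-- The underlying set of the `p`-Wasserstein space over a metric space `Y`: the Borel probability
measures on `Y` with finite `p`-th moment. -/
abbrev WassersteinSpace (p : ℝ) (Y : Type*) [MetricSpace Y] [MeasurableSpace Y] : Type _ :=
  {μ : ProbabilityMeasure Y // ∃ y₀ : Y, ∫⁻ y, edist y y₀ ^ p ∂(μ : Measure Y) < ∞}

namespace WassersteinSpace

variable {p : ℝ} {Y : Type*} [MetricSpace Y] [MeasurableSpace Y]

/-- The `p`-Wasserstein distance, the `p`-th root of the infimum over all couplings `π` of the
integral of `d(x, y) ^ p` with respect to `π`. It is written with values in `[0, ∞]`, like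
`edist`, so that no convention about divergent integrals enters. -/
def wDist (μ ν : WassersteinSpace p Y) : ℝ≥0∞ :=
  (⨅ π ∈ couplings μ.1 ν.1, ∫⁻ z, edist z.1 z.2 ^ p ∂(π : Measure (Y × Y))) ^ (1 / p)

/-- An isometry of the `p`-Wasserstein space: a distance preserving map of the space onto itself. -/
structure IsIsometry (Ψ : WassersteinSpace p Y → WassersteinSpace p Y) : Prop where
  wDist_eq : ∀ μ ν, wDist (Ψ μ) (Ψ ν) = wDist μ ν
  surjective : Function.Surjective Ψ

/-- The push-forward `ψ_#` of measures under an isometry `ψ` of the base space (a distance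
preserving bijection of `Y`), as a map of the `p`-Wasserstein space to itself. -/
def push [BorelSpace Y] (ψ : Y ≃ᵢ Y) (μ : WassersteinSpace p Y) : WassersteinSpace p Y :=
  ⟨μ.1.map (f := ψ) ψ.continuous.measurable.aemeasurable, by
    obtain ⟨y₀, h⟩ := μ.2
    refine ⟨ψ y₀, ?_⟩
    have hm : Measurable fun y : Y => edist y (ψ y₀) ^ p :=
      (continuous_id.edist continuous_const).measurable.pow_const p
    rw [ProbabilityMeasure.toMeasure_map, lintegral_map hm ψ.continuous.measurable]
    simpa only [ψ.isometry.edist_eq] using h⟩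

end WassersteinSpace

/-- The unit sphere `{x ∈ ℝ^(n+1) : ‖x‖ = 1}`, a subtype of Euclidean space. Its metric is the
chordal distance `‖x - y‖` and its measurable sets are the Borel sets. -/
abbrev UnitSphere (n : ℕ) : Type :=
  Metric.sphere (0 : EuclideanSpace ℝ (Fin (n + 1))) 1

end

set_option linter.unusedSectionVars false

/-! ### Squared Wasserstein distance over a compact base -/

namespace WassersteinSpace

section CompactBase

variable {Y : Type*} [MetricSpace Y] [CompactSpace Y] [MeasurableSpace Y] [BorelSpace Y]

/-! Squared distance 4 singles out antipodal pairs of Dirac masses, so an isometry permutes Dirac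
masses through an isometry of the sphere (`exists_isometryEquiv`). Undoing it leaves a
distance-preserving `Φ` that fixes every Dirac mass, and hence preserves `∫ dist x u ^ 2` for each
`u`.

If `μ` lives on the great subsphere orthogonal to `u`, then moving `x` to `4/5 x + 3/5 u` gives
equality in an inequality between quantities preserved by `Φ`; equality forces `Φ μ` onto the same
subsphere (`ae_inner_eq_zero`). Intersecting subspheres, `Φ` fixes every measure on a pair `{a, -a}`
(`map_eq_of_ae_antipodal`).

The distances from `μ` to such measures determine `∫ |⟪x, a⟫ + l|` for all `l`, by a Lagrange
multiplier argument (`integral_abs_le_of_sqDist_eq`). These integrals determine the law of `⟪x, a⟫`,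
and the laws for all `a` determine `μ` by Cramér–Wold, so `Φ` is the identity. -/

theorem integrable_of_continuous {X : Type*} [TopologicalSpace X] [CompactSpace X]
    [MeasurableSpace X] [OpensMeasurableSpace X] (μ : Measure X) [IsFiniteMeasure μ]
    {f : X → ℝ} (hf : Continuous f) : Integrable f μ :=
  hf.integrable_of_hasCompactSupport (HasCompactSupport.of_compactSpace f)

/-- Every probability measure on a compact space has finite second moment. -/
def ofProb (μ : ProbabilityMeasure Y) : WassersteinSpace 2 Y :=
  ⟨μ, by
    obtain ⟨y₀⟩ := μ.nonempty
    refine ⟨y₀, ?_⟩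
    have h : ∀ y : Y, edist y y₀ ^ (2 : ℝ) ≤ ENNReal.ofReal (Metric.diam (univ : Set Y)) ^ (2 : ℝ) := by
      intro y
      refine ENNReal.rpow_le_rpow ?_ (by norm_num)
      rw [edist_dist]
      exact ENNReal.ofReal_le_ofReal
        (Metric.dist_le_diam_of_mem isCompact_univ.isBounded (mem_univ _) (mem_univ _))
    refine (lintegral_mono h).trans_lt ?_
    simp⟩

/-- The Dirac mass at `y`, as a point of the Wasserstein space. -/
noncomputable def diracW (y : Y) : WassersteinSpace 2 Y :=
  ofProb ⟨Measure.dirac y, inferInstance⟩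

/-- The measure underlying a point of the Wasserstein space. -/
abbrev meas (μ : WassersteinSpace 2 Y) : Measure Y := (μ.1 : Measure Y)

@[simp] theorem meas_diracW (y : Y) : (diracW y).meas = Measure.dirac y := rfl

theorem meas_injective : Function.Injective (meas : WassersteinSpace 2 Y → Measure Y) :=
  fun _ _ h => Subtype.ext (Subtype.ext h)

/-- The square of the Wasserstein distance, as a real number. -/
noncomputable def sqDist (μ ν : WassersteinSpace 2 Y) : ℝ :=
  (⨅ π ∈ couplings μ.1 ν.1, ∫⁻ z, edist z.1 z.2 ^ (2 : ℝ) ∂(π : Measure (Y × Y))).toReal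

theorem sqDist_eq_of_wDist_eq {μ ν μ' ν' : WassersteinSpace 2 Y}
    (h : wDist μ ν = wDist μ' ν') : sqDist μ ν = sqDist μ' ν' := by
  have := ENNReal.rpow_left_injective (x := (1 / 2 : ℝ)) (by norm_num) h
  rw [sqDist, sqDist, this]

variable {μ ν : WassersteinSpace 2 Y} {π : ProbabilityMeasure (Y × Y)}

theorem lintegral_edist_sq (π : Measure (Y × Y)) [IsFiniteMeasure π] :
    ∫⁻ z, edist z.1 z.2 ^ (2 : ℝ) ∂π = ENNReal.ofReal (∫ z, dist z.1 z.2 ^ 2 ∂π) := by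
  rw [ofReal_integral_eq_lintegral_ofReal (integrable_of_continuous π (by fun_prop))
    (Filter.Eventually.of_forall fun z => by positivity)]
  refine lintegral_congr fun z => ?_
  rw [edist_dist, ENNReal.ofReal_pow dist_nonneg]
  exact ENNReal.rpow_natCast _ 2

theorem sqDist_le (hπ : π ∈ couplings μ.1 ν.1) :
    sqDist μ ν ≤ ∫ z, dist z.1 z.2 ^ 2 ∂(π : Measure (Y × Y)) := by
  refine ENNReal.toReal_le_of_le_ofReal (integral_nonneg fun z => by positivity) ?_
  rw [← lintegral_edist_sq]
  exact iInf₂_le π hπ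

/-- The product measure of two points of the Wasserstein space. -/
noncomputable def prodCoupling (μ ν : WassersteinSpace 2 Y) : ProbabilityMeasure (Y × Y) :=
  ⟨μ.meas.prod ν.meas, inferInstance⟩

theorem prodCoupling_mem (μ ν : WassersteinSpace 2 Y) :
    prodCoupling μ ν ∈ couplings μ.1 ν.1 :=
  ⟨Measure.fst_prod, Measure.snd_prod⟩

/-- Almost optimal couplings suffice throughout, so existence of optimal ones is never needed. -/
theorem exists_coupling_lt (μ ν : WassersteinSpace 2 Y) {ε : ℝ} (hε : 0 < ε) :
    ∃ π ∈ couplings μ.1 ν.1,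
      ∫ z, dist z.1 z.2 ^ 2 ∂(π : Measure (Y × Y)) < sqDist μ ν + ε := by
  have hfin : (⨅ π ∈ couplings μ.1 ν.1, ∫⁻ z, edist z.1 z.2 ^ (2 : ℝ) ∂(π : Measure (Y × Y)))
      ≠ ∞ := by
    refine ne_top_of_le_ne_top ?_ (iInf₂_le _ (prodCoupling_mem μ ν))
    rw [lintegral_edist_sq]
    exact ENNReal.ofReal_ne_top
  have hlt := ENNReal.lt_add_right hfin (ENNReal.ofReal_pos.2 hε).ne'
  simp only [iInf_lt_iff] at hlt
  obtain ⟨π, hπ, h⟩ := hlt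
  refine ⟨π, hπ, ?_⟩
  rw [lintegral_edist_sq, ← ENNReal.ofReal_toReal hfin,
    ← ENNReal.ofReal_add ENNReal.toReal_nonneg hε.le] at h
  exact (ENNReal.ofReal_lt_ofReal_iff (add_pos_of_nonneg_of_pos ENNReal.toReal_nonneg hε)).1 h

theorem integral_fst_of_mem {μ ν : ProbabilityMeasure Y} (hπ : π ∈ couplings μ ν) {f : Y → ℝ}
    (hf : Measurable f) :
    ∫ z, f z.1 ∂(π : Measure (Y × Y)) = ∫ x, f x ∂(μ : Measure Y) := by
  rw [← hπ.1, Measure.fst, integral_map measurable_fst.aemeasurable hf.aestronglyMeasurable]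

theorem integral_snd_of_mem {μ ν : ProbabilityMeasure Y} (hπ : π ∈ couplings μ ν) {f : Y → ℝ}
    (hf : Measurable f) :
    ∫ z, f z.2 ∂(π : Measure (Y × Y)) = ∫ x, f x ∂(ν : Measure Y) := by
  rw [← hπ.2, Measure.snd, integral_map measurable_snd.aemeasurable hf.aestronglyMeasurable]

theorem ae_snd_of_mem {μ ν : ProbabilityMeasure Y} (hπ : π ∈ couplings μ ν) {p : Y → Prop}
    (h : ∀ᵐ y ∂(ν : Measure Y), p y) : ∀ᵐ z ∂(π : Measure (Y × Y)), p z.2 := by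
  rw [← hπ.2] at h
  exact ae_of_ae_map measurable_snd.aemeasurable h

/-- The push-forward of `μ` under a measurable self-map. -/
noncomputable def mapW (μ : WassersteinSpace 2 Y) {T : Y → Y} (hT : Measurable T) :
    WassersteinSpace 2 Y :=
  ofProb (μ.1.map hT.aemeasurable)

theorem integral_mapW (μ : WassersteinSpace 2 Y) {T : Y → Y} (hT : Measurable T) {f : Y → ℝ}
    (hf : Measurable f) : ∫ y, f y ∂(mapW μ hT).meas = ∫ x, f (T x) ∂μ.meas :=
  integral_map hT.aemeasurable hf.aestronglyMeasurable

theorem sqDist_mapW_le (μ : WassersteinSpace 2 Y) {T : Y → Y} (hT : Measurable T) :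
    sqDist μ (mapW μ hT) ≤ ∫ x, dist x (T x) ^ 2 ∂μ.meas := by
  have hm : Measurable fun x => (x, T x) := measurable_id.prodMk hT
  have hπ : μ.1.map hm.aemeasurable ∈ couplings μ.1 (mapW μ hT).1 := by
    constructor
    · rw [ProbabilityMeasure.toMeasure_map, Measure.fst_map_prodMk hT, Measure.map_id']
    · rw [ProbabilityMeasure.toMeasure_map, Measure.snd_map_prodMk (X := fun x => x) measurable_id]; rfl
  refine (sqDist_le hπ).trans_eq ?_
  rw [ProbabilityMeasure.toMeasure_map, integral_map hm.aemeasurable]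
  exact (Continuous.measurable (by fun_prop)).aestronglyMeasurable

/-- Every coupling with a Dirac mass has the same cost, since its second coordinate is almost surely
`u`. -/
theorem sqDist_diracW (μ : WassersteinSpace 2 Y) (u : Y) :
    sqDist μ (diracW u) = ∫ x, dist x u ^ 2 ∂μ.meas := by
  have key : ∀ π ∈ couplings μ.1 (diracW u).1,
      ∫ z, dist z.1 z.2 ^ 2 ∂(π : Measure (Y × Y)) = ∫ x, dist x u ^ 2 ∂μ.meas := by
    intro π hπ
    have h : ∀ᵐ y ∂((diracW u).1 : Measure Y), y = u := by
      change ∀ᵐ y ∂Measure.dirac u, y = u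
      rw [ae_dirac_eq]; exact Filter.mem_pure.2 rfl
    rw [← integral_fst_of_mem hπ (f := fun x => dist x u ^ 2)
      (Continuous.measurable (by fun_prop))]
    refine integral_congr_ae ?_
    filter_upwards [ae_snd_of_mem hπ h] with z hz
    rw [hz]
  refine le_antisymm ((sqDist_le (prodCoupling_mem _ _)).trans_eq
    (key _ (prodCoupling_mem _ _))) (le_of_forall_pos_le_add fun ε hε => ?_)
  obtain ⟨π, hπ, h⟩ := exists_coupling_lt μ (diracW u) hε
  rw [key π hπ] at h
  exact h.le

theorem sqDist_diracW_diracW (x y : Y) : sqDist (diracW x) (diracW y) = dist x y ^ 2 := by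
  rw [sqDist_diracW, meas_diracW, integral_dirac]

theorem diracW_injective : Function.Injective (diracW : Y → WassersteinSpace 2 Y) := by
  intro x y h
  have h' := sqDist_diracW_diracW x y
  rw [h, sqDist_diracW_diracW, dist_self] at h'
  simpa using h'.symm

theorem push_diracW (ψ : Y ≃ᵢ Y) (y : Y) : push ψ (diracW y) = diracW (ψ y) :=
  meas_injective <| Measure.map_dirac' ψ.continuous.measurable y

theorem push_push_symm {p : ℝ} (ψ : Y ≃ᵢ Y) (μ : WassersteinSpace p Y) :
    push ψ (push ψ.symm μ) = μ := by
  refine Subtype.ext (Subtype.ext ?_)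
  change ((μ.1 : Measure Y).map ψ.symm).map ψ = μ.1
  rw [Measure.map_map ψ.continuous.measurable ψ.symm.continuous.measurable]
  have : (ψ ∘ ψ.symm : Y → Y) = id := by ext; simp
  rw [this, Measure.map_id]

theorem sqDist_push_le (ψ : Y ≃ᵢ Y) (μ ν : WassersteinSpace 2 Y) :
    sqDist (push ψ μ) (push ψ ν) ≤ sqDist μ ν := by
  refine le_of_forall_pos_le_add fun ε hε => ?_
  obtain ⟨π, hπ, h⟩ := exists_coupling_lt μ ν hε
  have hψ := ψ.continuous.measurable
  have hm : Measurable (Prod.map ψ ψ) := hψ.prodMap hψ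
  have hmem : π.map hm.aemeasurable ∈ couplings (push ψ μ).1 (push ψ ν).1 := by
    constructor
    · change ((π : Measure (Y × Y)).map (Prod.map ψ ψ)).map Prod.fst = (μ.1 : Measure Y).map ψ
      rw [Measure.map_map measurable_fst hm, ← hπ.1, Measure.fst,
        Measure.map_map hψ measurable_fst]
      rfl
    · change ((π : Measure (Y × Y)).map (Prod.map ψ ψ)).map Prod.snd = (ν.1 : Measure Y).map ψ
      rw [Measure.map_map measurable_snd hm, ← hπ.2, Measure.snd,
        Measure.map_map hψ measurable_snd]
      rfl
  refine (sqDist_le hmem).trans (le_trans (le_of_eq ?_) h.le)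
  rw [ProbabilityMeasure.toMeasure_map, integral_map hm.aemeasurable
    (Continuous.measurable (by fun_prop)).aestronglyMeasurable]
  simp [ψ.dist_eq]

theorem sqDist_push (ψ : Y ≃ᵢ Y) (μ ν : WassersteinSpace 2 Y) :
    sqDist (push ψ μ) (push ψ ν) = sqDist μ ν := by
  refine le_antisymm (sqDist_push_le ψ μ ν) ?_
  have h : ∀ κ : WassersteinSpace 2 Y, push ψ.symm (push ψ κ) = κ := push_push_symm ψ.symm
  simpa only [h] using sqDist_push_le ψ.symm (push ψ μ) (push ψ ν)

end CompactBase

end WassersteinSpace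

/-! ### Dirac masses on the sphere -/

namespace UnitSphere

open WassersteinSpace

variable {n : ℕ}

theorem inner_self_eq_one (x : UnitSphere n) :
    inner ℝ (x : EuclideanSpace ℝ (Fin (n + 1))) (x : EuclideanSpace ℝ (Fin (n + 1))) = 1 := by
  rw [real_inner_self_eq_norm_sq, norm_eq_of_mem_sphere, one_pow]

theorem dist_sq_eq (x y : UnitSphere n) :
    dist x y ^ 2 = 2 - 2 * inner ℝ (x : EuclideanSpace ℝ (Fin (n + 1))) y := by
  rw [Subtype.dist_eq, dist_eq_norm, norm_sub_sq_real, norm_eq_of_mem_sphere,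
    norm_eq_of_mem_sphere]
  ring

theorem dist_sq_add_dist_sq_neg (x y : UnitSphere n) : dist x y ^ 2 + dist x (-y) ^ 2 = 4 := by
  rw [dist_sq_eq, dist_sq_eq, coe_neg_sphere, inner_neg_right]
  ring

theorem dist_sq_neg_right_self (x : UnitSphere n) : dist x (-x) ^ 2 = 4 := by
  have := dist_sq_add_dist_sq_neg x x
  rwa [dist_self, zero_pow two_ne_zero, zero_add] at this

/-- Only Dirac masses have a point at the maximal distance `2`. -/
theorem eq_diracW_of_sqDist_eq_four {μ ν : WassersteinSpace 2 (UnitSphere n)}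
    (h : sqDist μ ν = 4) : ∃ y, μ = diracW y := by
  have h4 : (4 : ℝ) ≤ ∫ z, dist z.1 z.2 ^ 2 ∂(μ.meas.prod ν.meas) :=
    h ▸ sqDist_le (prodCoupling_mem μ ν)
  -- The two integrands add up to 4 pointwise, so a product coupling of cost at least 4 has `x = -y`
  -- almost surely.
  have hsum : ∫ z, dist z.1 z.2 ^ 2 ∂(μ.meas.prod ν.meas)
      + ∫ z, dist z.1 (-z.2) ^ 2 ∂(μ.meas.prod ν.meas) = 4 := by
    rw [← integral_add (integrable_of_continuous _ (by fun_prop))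
      (integrable_of_continuous _ (by fun_prop))]
    simp [dist_sq_add_dist_sq_neg]
  have h0 : ∫ z, dist z.1 (-z.2) ^ 2 ∂(μ.meas.prod ν.meas) = 0 :=
    le_antisymm (by linarith) (integral_nonneg fun z => by positivity)
  rw [integral_eq_zero_iff_of_nonneg (fun z => by positivity)
    (integrable_of_continuous _ (by fun_prop))] at h0
  have hae : ∀ᵐ z ∂(μ.meas.prod ν.meas), z.1 = -z.2 := by
    filter_upwards [h0] with z hz
    simpa using hz
  -- With the factors swapped, Fubini yields one `y` such that `x = -y` for `μ`-almost every `x`.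
  have hae' : ∀ᵐ z ∂(ν.meas.prod μ.meas), z.2 = -z.1 := by
    rw [← Measure.prod_swap] at hae
    exact ae_of_ae_map measurable_swap.aemeasurable hae
  obtain ⟨y, hy⟩ := (Measure.ae_ae_of_ae_prod hae').exists
  refine ⟨-y, meas_injective ?_⟩
  have hmap : μ.meas.map id = μ.meas.map fun _ => -y := Measure.map_congr hy
  rwa [Measure.map_id, Measure.map_const, measure_univ, one_smul] at hmap

theorem sqDist_diracW_neg (y : UnitSphere n) : sqDist (diracW y) (diracW (-y)) = 4 := by
  rw [sqDist_diracW_diracW, dist_sq_neg_right_self]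

/-- An isometry of the Wasserstein space acts on Dirac masses through an isometry of the sphere. -/
theorem exists_isometryEquiv {Ψ : WassersteinSpace 2 (UnitSphere n) → WassersteinSpace 2 (UnitSphere n)}
    (hΨ : ∀ μ ν, sqDist (Ψ μ) (Ψ ν) = sqDist μ ν) (hsurj : Function.Surjective Ψ) :
    ∃ ψ : UnitSphere n ≃ᵢ UnitSphere n, ∀ y, Ψ (diracW y) = diracW (ψ y) := by
  have hex : ∀ y, ∃ z, Ψ (diracW y) = diracW z := fun y =>
    eq_diracW_of_sqDist_eq_four (ν := Ψ (diracW (-y))) (by rw [hΨ, sqDist_diracW_neg])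
  choose f hf using hex
  have hiso : Isometry f := Isometry.of_dist_eq fun x y => by
    have h : dist (f x) (f y) ^ 2 = dist x y ^ 2 := by
      rw [← sqDist_diracW_diracW, ← hf, ← hf, hΨ, sqDist_diracW_diracW]
    exact (pow_left_inj₀ dist_nonneg dist_nonneg two_ne_zero).1 h
  -- Preimages of an antipodal Dirac pair are again at squared distance 4, hence Dirac.
  have hfsurj : ∀ y, ∃ x, f x = y := fun y => by
    obtain ⟨μ, hμ⟩ := hsurj (diracW y)
    obtain ⟨ν, hν⟩ := hsurj (diracW (-y))
    obtain ⟨x, rfl⟩ := eq_diracW_of_sqDist_eq_four (μ := μ) (ν := ν)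
      (by rw [← hΨ, hμ, hν, sqDist_diracW_neg])
    exact ⟨x, diracW_injective ((hf x).symm.trans hμ)⟩
  choose g hg using hfsurj
  exact ⟨IsometryEquiv.mk' f g hg hiso, hf⟩

/-! ### Invariance of great subspheres -/

section Orthogonal

variable {E : Type*} [NormedAddCommGroup E] [InnerProductSpace ℝ E]

theorem norm_sq_sub_smul_add_smul {x y u : E} (hx : inner ℝ x x = 1) (hy : inner ℝ y y = 1)
    (hu : inner ℝ u u = 1) :
    ‖y - ((4 / 5 : ℝ) • x + (3 / 5 : ℝ) • u)‖ ^ 2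
      = 2 - 8 / 5 * inner ℝ x y - 6 / 5 * inner ℝ y u + 24 / 25 * inner ℝ x u := by
  rw [← real_inner_self_eq_norm_sq]
  simp only [inner_sub_left, inner_sub_right, inner_add_left, inner_add_right,
    real_inner_smul_left, real_inner_smul_right, hx, hy, hu, real_inner_comm x y,
    real_inner_comm y u, real_inner_comm x u]
  ring

theorem norm_sq_smul_add_smul {x u : E} (hx : inner ℝ x x = 1) (hu : inner ℝ u u = 1) :
    ‖(4 / 5 : ℝ) • x + (3 / 5 : ℝ) • u‖ ^ 2 = 1 + 24 / 25 * inner ℝ x u := by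
  rw [← real_inner_self_eq_norm_sq]
  simp only [inner_add_left, inner_add_right,
    real_inner_smul_left, real_inner_smul_right, hx, hu, real_inner_comm x u]
  ring

/-- With `w = 4/5 x + 3/5 u`, the unit vector `y` can be near `w` only if `‖w‖` is near 1, and `‖w‖
^ 2 - 1` is `24/25 ⟪x, u⟫`. The bound `‖w‖ ≤ 7/5` gives the constant `25/4`, rounded up to 10. -/
theorem inner_sq_le {x y u : E} (hx : inner ℝ x x = 1) (hy : inner ℝ y y = 1)
    (hu : inner ℝ u u = 1) :
    inner ℝ x u ^ 2 ≤ 10 * ‖y - ((4 / 5 : ℝ) • x + (3 / 5 : ℝ) • u)‖ ^ 2 := by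
  have h1 := norm_sq_smul_add_smul hx hu
  set w := (4 / 5 : ℝ) • x + (3 / 5 : ℝ) • u
  have hny : ‖y‖ = 1 := by
    rw [real_inner_self_eq_norm_sq] at hy
    exact (pow_eq_one_iff_of_nonneg (norm_nonneg _) two_ne_zero).1 hy
  have h2 : (1 - ‖w‖) ^ 2 ≤ ‖y - w‖ ^ 2 := by
    rw [← hny]
    exact sq_le_sq' (by linarith [norm_sub_norm_le w y, norm_sub_rev w y])
      (norm_sub_norm_le y w)
  have h3 : inner ℝ x u ≤ 1 := by
    have := norm_sub_sq_real x u
    rw [← real_inner_self_eq_norm_sq x, ← real_inner_self_eq_norm_sq u, hx, hu] at this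
    nlinarith [sq_nonneg ‖x - u‖]
  have hw : ‖w‖ ≤ 7 / 5 := abs_le_of_sq_le_sq' (by linarith) (by norm_num) |>.2
  have h4 : (24 / 25 * inner ℝ x u) ^ 2 = (1 - ‖w‖) ^ 2 * (1 + ‖w‖) ^ 2 := by
    rw [← mul_pow, show 24 / 25 * inner ℝ x u = ‖w‖ ^ 2 - 1 by linarith]; ring
  have h5 : (1 + ‖w‖) ^ 2 ≤ (12 / 5) ^ 2 :=
    pow_le_pow_left₀ (by positivity) (by linarith) 2
  nlinarith [mul_le_mul_of_nonneg_left h5 (sq_nonneg (1 - ‖w‖))]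

end Orthogonal

/-- Up to the nonnegative defect `‖y - w‖ ^ 2`, this relates only squared distances, whose integrals
`Φ` controls. The coefficients satisfy `(4/5)^2 + (3/5)^2 = 1`, so the defect can vanish when `x` is
orthogonal to `u`. -/
theorem norm_sq_shift_add (x y u : UnitSphere n) :
    ‖(y : EuclideanSpace ℝ (Fin (n + 1))) - ((4 / 5 : ℝ) • (x : EuclideanSpace ℝ (Fin (n + 1)))
        + (3 / 5 : ℝ) • (u : EuclideanSpace ℝ (Fin (n + 1))))‖ ^ 2 + 12 / 25 * dist x u ^ 2
      = 4 / 5 * dist x y ^ 2 + 3 / 5 * dist y u ^ 2 + 4 / 25 := by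
  rw [norm_sq_sub_smul_add_smul (inner_self_eq_one x) (inner_self_eq_one y) (inner_self_eq_one u),
    dist_sq_eq, dist_sq_eq, dist_sq_eq]
  ring

theorem smul_add_smul_ne_zero (x u : UnitSphere n) :
    (4 / 5 : ℝ) • (x : EuclideanSpace ℝ (Fin (n + 1)))
      + (3 / 5 : ℝ) • (u : EuclideanSpace ℝ (Fin (n + 1))) ≠ 0 := by
  intro h
  have h' := congrArg norm (eq_neg_of_add_eq_zero_left h)
  rw [norm_neg, norm_smul, norm_smul, norm_eq_of_mem_sphere, norm_eq_of_mem_sphere] at h'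
  norm_num at h'

/-- The map `x ↦ 4/5 x + 3/5 u`, followed by the radial projection to the sphere. -/
noncomputable def shift (u x : UnitSphere n) : UnitSphere n :=
  ⟨‖(4 / 5 : ℝ) • (x : EuclideanSpace ℝ (Fin (n + 1)))
      + (3 / 5 : ℝ) • (u : EuclideanSpace ℝ (Fin (n + 1)))‖⁻¹ •
    ((4 / 5 : ℝ) • (x : EuclideanSpace ℝ (Fin (n + 1)))
      + (3 / 5 : ℝ) • (u : EuclideanSpace ℝ (Fin (n + 1)))), by
    rw [mem_sphere_zero_iff_norm, norm_smul, norm_inv, norm_norm,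
      inv_mul_cancel₀ (norm_ne_zero_iff.2 (smul_add_smul_ne_zero x u))]⟩

theorem continuous_shift (u : UnitSphere n) : Continuous (shift u) := by
  have hc : Continuous fun x : UnitSphere n => (4 / 5 : ℝ) • (x : EuclideanSpace ℝ (Fin (n + 1)))
      + (3 / 5 : ℝ) • (u : EuclideanSpace ℝ (Fin (n + 1))) := by fun_prop
  exact Continuous.subtype_mk ((hc.norm.inv₀ fun x =>
    norm_ne_zero_iff.2 (smul_add_smul_ne_zero x u)).smul hc) _

theorem coe_shift_of_inner_eq_zero {u x : UnitSphere n}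
    (h : inner ℝ (x : EuclideanSpace ℝ (Fin (n + 1))) u = 0) :
    (shift u x : EuclideanSpace ℝ (Fin (n + 1))) = (4 / 5 : ℝ) • (x : EuclideanSpace ℝ (Fin (n + 1)))
      + (3 / 5 : ℝ) • (u : EuclideanSpace ℝ (Fin (n + 1))) := by
  have h1 := norm_sq_smul_add_smul (inner_self_eq_one x) (inner_self_eq_one u)
  rw [h, mul_zero, add_zero] at h1
  change ‖_‖⁻¹ • _ = _
  rw [(pow_eq_one_iff_of_nonneg (norm_nonneg _) two_ne_zero).1 h1, inv_one, one_smul]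

variable {Φ : WassersteinSpace 2 (UnitSphere n) → WassersteinSpace 2 (UnitSphere n)}

theorem integral_dist_sq_eq (hΦ : ∀ μ ν, sqDist (Φ μ) (Φ ν) = sqDist μ ν)
    (hfix : ∀ y, Φ (diracW y) = diracW y) (μ : WassersteinSpace 2 (UnitSphere n))
    (u : UnitSphere n) : ∫ x, dist x u ^ 2 ∂(Φ μ).meas = ∫ x, dist x u ^ 2 ∂μ.meas := by
  rw [← sqDist_diracW, ← sqDist_diracW, ← hΦ μ, hfix]

/-- Concentration on a great subsphere is preserved. -/
theorem ae_inner_eq_zero (hΦ : ∀ μ ν, sqDist (Φ μ) (Φ ν) = sqDist μ ν)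
    (hfix : ∀ y, Φ (diracW y) = diracW y) {μ : WassersteinSpace 2 (UnitSphere n)}
    {u : UnitSphere n}
    (h : ∀ᵐ (x : UnitSphere n) ∂μ.meas, inner ℝ (x : EuclideanSpace ℝ (Fin (n + 1))) u = 0) :
    ∀ᵐ (x : UnitSphere n) ∂(Φ μ).meas, inner ℝ (x : EuclideanSpace ℝ (Fin (n + 1))) u = 0 := by
  have hT := (continuous_shift u).measurable
  have hc := continuous_shift u
  set ν := mapW μ hT with hν
  -- The defect vanishes along the graph of `shift u`, which is an admissible plan from `μ` to `ν`.
  have hle : 4 / 5 * sqDist μ ν + 3 / 5 * ∫ y, dist y u ^ 2 ∂ν.meas + 4 / 25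
      ≤ 12 / 25 * ∫ x, dist x u ^ 2 ∂μ.meas := by
    rw [hν, integral_mapW μ hT (Continuous.measurable (by fun_prop)), ← hν]
    have h1 := sqDist_mapW_le μ hT
    have h2 : ∫ x, 12 / 25 * dist x u ^ 2 ∂μ.meas
        = ∫ x, (4 / 5 * dist x (shift u x) ^ 2 + 3 / 5 * dist (shift u x) u ^ 2 + 4 / 25) ∂μ.meas := by
      refine integral_congr_ae ?_
      filter_upwards [h] with x hx
      rw [← norm_sq_shift_add, coe_shift_of_inner_eq_zero hx, sub_self, norm_zero]
      ring
    rw [integral_const_mul, integral_add (integrable_of_continuous _ (by fun_prop))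
      (integrable_const _), integral_add (integrable_of_continuous _ (by fun_prop))
      (integrable_of_continuous _ (by fun_prop)), integral_const_mul, integral_const_mul,
      integral_const] at h2
    simp only [probReal_univ, one_smul] at h2
    linarith
  -- Every term is invariant under `Φ`, so nearly optimal plans from `Φ μ` to `Φ ν` have nearly zero
  -- defect.
  rw [← hΦ, ← integral_dist_sq_eq hΦ hfix ν, ← integral_dist_sq_eq hΦ hfix μ] at hle
  have hsq : ∫ x, inner ℝ (x : EuclideanSpace ℝ (Fin (n + 1))) u ^ 2 ∂(Φ μ).meas = 0 := by
    refine le_antisymm (le_of_forall_pos_le_add fun ε hε => ?_)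
      (integral_nonneg fun x => sq_nonneg _)
    -- The factor 8 is `10 * 4/5`, the weight of the transport cost in `hpt`.
    obtain ⟨π, hπ, hlt⟩ := exists_coupling_lt (Φ μ) (Φ ν) (show 0 < ε / 8 by positivity)
    have hpt : ∀ z : UnitSphere n × UnitSphere n,
        inner ℝ (z.1 : EuclideanSpace ℝ (Fin (n + 1))) u ^ 2
          ≤ 10 * (4 / 5 * dist z.1 z.2 ^ 2 + 3 / 5 * dist z.2 u ^ 2 + 4 / 25
            - 12 / 25 * dist z.1 u ^ 2) := fun z => by
      rw [← norm_sq_shift_add, add_sub_cancel_right]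
      exact inner_sq_le (inner_self_eq_one _) (inner_self_eq_one _) (inner_self_eq_one _)
    have hint := integral_mono (μ := (π : Measure (UnitSphere n × UnitSphere n)))
      (integrable_of_continuous _ (by fun_prop)) (integrable_of_continuous _ (by fun_prop)) hpt
    rw [integral_const_mul, integral_sub (integrable_of_continuous _ (by fun_prop))
      (integrable_of_continuous _ (by fun_prop)),
      integral_add (integrable_of_continuous _ (by fun_prop)) (integrable_const _),
      integral_add (integrable_of_continuous _ (by fun_prop))
      (integrable_of_continuous _ (by fun_prop)), integral_const_mul, integral_const_mul,
      integral_const_mul, integral_const,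
      integral_fst_of_mem hπ (f := fun x => inner ℝ (x : EuclideanSpace ℝ (Fin (n + 1))) u ^ 2)
        (Continuous.measurable (by fun_prop)),
      integral_fst_of_mem hπ (f := fun x => dist x u ^ 2) (Continuous.measurable (by fun_prop)),
      integral_snd_of_mem hπ (f := fun x => dist x u ^ 2) (Continuous.measurable (by fun_prop))]
      at hint
    simp only [probReal_univ, one_smul] at hint
    linarith
  have hcu : Continuous fun x : UnitSphere n =>
      inner ℝ (x : EuclideanSpace ℝ (Fin (n + 1))) u ^ 2 := by fun_prop
  rw [integral_eq_zero_iff_of_nonneg (fun z => sq_nonneg _) (integrable_of_continuous _ hcu)] at hsq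
  filter_upwards [hsq] with x hx
  simpa using hx

/-! ### Measures on antipodal pairs are fixed -/

/-- A point orthogonal to an orthonormal basis of the complement of `a` is `a` or `-a`. -/
theorem eq_or_eq_neg_of_inner_basis {a x : UnitSphere n}
    (h : ∀ i, inner ℝ (x : EuclideanSpace ℝ (Fin (n + 1)))
      (stdOrthonormalBasis ℝ (ℝ ∙ (a : EuclideanSpace ℝ (Fin (n + 1))))ᗮ i :
        EuclideanSpace ℝ (Fin (n + 1))) = 0) : x = a ∨ x = -a := by
  set K := (ℝ ∙ (a : EuclideanSpace ℝ (Fin (n + 1))))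
  have hx : (x : EuclideanSpace ℝ (Fin (n + 1))) ∈ Kᗮᗮ := by
    rw [Submodule.mem_orthogonal]
    intro v hv
    have hv' := (stdOrthonormalBasis ℝ Kᗮ).sum_repr ⟨v, hv⟩
    have hv'' : v = ∑ i, (stdOrthonormalBasis ℝ Kᗮ).repr ⟨v, hv⟩ i •
        (stdOrthonormalBasis ℝ Kᗮ i : EuclideanSpace ℝ (Fin (n + 1))) := by
      conv_lhs => rw [show v = ((⟨v, hv⟩ : Kᗮ) : EuclideanSpace ℝ (Fin (n + 1))) from rfl, ← hv']
      simp
    rw [hv'', sum_inner]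
    refine Finset.sum_eq_zero fun i _ => ?_
    rw [real_inner_smul_left, real_inner_comm, h i, mul_zero]
  rw [Submodule.orthogonal_orthogonal, Submodule.mem_span_singleton] at hx
  obtain ⟨c, hc⟩ := hx
  have hn := congrArg norm hc
  rw [norm_smul, norm_eq_of_mem_sphere, norm_eq_of_mem_sphere, mul_one, Real.norm_eq_abs] at hn
  rcases eq_or_eq_neg_of_abs_eq hn with rfl | rfl
  · exact Or.inl (Subtype.ext (by rw [← hc, one_smul]))
  · exact Or.inr (Subtype.ext (by rw [← hc, coe_neg_sphere, neg_smul, one_smul]))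

/-- A measure on an antipodal pair is determined by its distance from one of the two points. -/
theorem eq_of_ae_antipodal {a : UnitSphere n} {μ ν : WassersteinSpace 2 (UnitSphere n)}
    (hμ : ∀ᵐ x ∂μ.meas, x = a ∨ x = -a) (hν : ∀ᵐ x ∂ν.meas, x = a ∨ x = -a)
    (h : ∫ x, dist x a ^ 2 ∂μ.meas = ∫ x, dist x a ^ 2 ∂ν.meas) : μ = ν := by
  refine meas_injective (ext_of_forall_integral_eq_of_IsFiniteMeasure fun f => ?_)
  have key : ∀ κ : WassersteinSpace 2 (UnitSphere n), (∀ᵐ x ∂κ.meas, x = a ∨ x = -a) →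
      ∫ x, f x ∂κ.meas = f a + (f (-a) - f a) / 4 * ∫ x, dist x a ^ 2 ∂κ.meas := by
    intro κ hκ
    -- On the pair, `dist x a ^ 2` takes the values 0 and 4, so `f` is affine in it.
    have : ∫ x, f x ∂κ.meas = ∫ x, (f a + (f (-a) - f a) / 4 * dist x a ^ 2) ∂κ.meas := by
      refine integral_congr_ae ?_
      filter_upwards [hκ] with x hx
      rcases hx with rfl | rfl
      · simp
      · rw [dist_comm, dist_sq_neg_right_self]
        ring
    rw [this, integral_add (integrable_const _) (integrable_of_continuous _ (by fun_prop)),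
      integral_const, integral_const_mul]
    simp
  rw [key μ hμ, key ν hν, h]

theorem map_eq_of_ae_antipodal (hΦ : ∀ μ ν, sqDist (Φ μ) (Φ ν) = sqDist μ ν)
    (hfix : ∀ y, Φ (diracW y) = diracW y) {a : UnitSphere n}
    {μ : WassersteinSpace 2 (UnitSphere n)} (hμ : ∀ᵐ x ∂μ.meas, x = a ∨ x = -a) : Φ μ = μ := by
  refine eq_of_ae_antipodal (a := a) ?_ hμ (integral_dist_sq_eq hΦ hfix μ a)
  set b := stdOrthonormalBasis ℝ (ℝ ∙ (a : EuclideanSpace ℝ (Fin (n + 1))))ᗮ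
  have hall : ∀ i, ∀ᵐ (x : UnitSphere n) ∂(Φ μ).meas, inner ℝ (x : EuclideanSpace ℝ (Fin (n + 1)))
      (b i : EuclideanSpace ℝ (Fin (n + 1))) = 0 := by
    intro i
    have hb : ‖(b i : EuclideanSpace ℝ (Fin (n + 1)))‖ = 1 := b.orthonormal.1 i
    refine ae_inner_eq_zero hΦ hfix (u := ⟨b i, mem_sphere_zero_iff_norm.2 hb⟩) ?_
    have ha : inner ℝ (a : EuclideanSpace ℝ (Fin (n + 1)))
        (b i : EuclideanSpace ℝ (Fin (n + 1))) = 0 :=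
      Submodule.mem_orthogonal_singleton_iff_inner_right.1 (b i).2
    filter_upwards [hμ] with x hx
    rcases hx with rfl | rfl
    · exact ha
    · rw [coe_neg_sphere, inner_neg_left, ha, neg_zero]
  filter_upwards [ae_all_iff.2 hall] with x hx
  exact eq_or_eq_neg_of_inner_basis hx

end UnitSphere

/-! ### Distances to measures on an antipodal pair -/

namespace UnitSphere

open WassersteinSpace

variable {n : ℕ}

/-- The nearest of `a` and `-a` to `x`, when the point `-a` carries the extra cost `4 l`. -/
noncomputable def nearest (a : UnitSphere n) (l : ℝ) (x : UnitSphere n) : UnitSphere n :=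
  if inner ℝ (x : EuclideanSpace ℝ (Fin (n + 1))) a + l < 0 then -a else a

theorem measurable_nearest (a : UnitSphere n) (l : ℝ) : Measurable (nearest a l) :=
  Measurable.ite (measurableSet_lt (Continuous.measurable (by fun_prop)) measurable_const)
    measurable_const measurable_const

theorem nearest_eq_or_eq_neg (a : UnitSphere n) (l : ℝ) (x : UnitSphere n) :
    nearest a l x = a ∨ nearest a l x = -a := by
  unfold nearest
  split_ifs
  · exact Or.inr rfl
  · exact Or.inl rfl

theorem cost_nearest (a : UnitSphere n) (l : ℝ) (x : UnitSphere n) :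
    dist x (nearest a l x) ^ 2 + l * dist (nearest a l x) a ^ 2
      = 2 + 2 * l - 2 * |inner ℝ (x : EuclideanSpace ℝ (Fin (n + 1))) a + l| := by
  unfold nearest
  split_ifs with h
  · rw [abs_of_neg h, dist_comm (-a), dist_sq_neg_right_self, dist_sq_eq, coe_neg_sphere,
      inner_neg_right]
    ring
  · rw [abs_of_nonneg (not_lt.1 h), dist_self, dist_sq_eq]
    ring

theorem le_cost {a y : UnitSphere n} (hy : y = a ∨ y = -a) (l : ℝ) (x : UnitSphere n) :
    2 + 2 * l - 2 * |inner ℝ (x : EuclideanSpace ℝ (Fin (n + 1))) a + l|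
      ≤ dist x y ^ 2 + l * dist y a ^ 2 := by
  rcases hy with rfl | rfl
  · rw [dist_self, dist_sq_eq]
    linarith [le_abs_self (inner ℝ (x : EuclideanSpace ℝ (Fin (n + 1))) y + l)]
  · rw [dist_comm (-a), dist_sq_neg_right_self, dist_sq_eq, coe_neg_sphere, inner_neg_right]
    linarith [neg_abs_le (inner ℝ (x : EuclideanSpace ℝ (Fin (n + 1))) a + l)]

/-- The integral encodes the minimum over `ν` on `{a, -a}` of `sqDist μ ν + l * ∫ dist y a ^ 2`,
attained by sending each point to its cheaper pole. The minimizer for `μ` is a competitor for `μ'`,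
which gives one inequality; symmetry gives the other. -/
theorem integral_abs_le_of_sqDist_eq {μ μ' : WassersteinSpace 2 (UnitSphere n)} {a : UnitSphere n}
    (h : ∀ ν : WassersteinSpace 2 (UnitSphere n), (∀ᵐ y ∂ν.meas, y = a ∨ y = -a) →
      sqDist μ ν = sqDist μ' ν) (l : ℝ) :
    ∫ x, |inner ℝ (x : EuclideanSpace ℝ (Fin (n + 1))) a + l| ∂μ.meas
      ≤ ∫ x, |inner ℝ (x : EuclideanSpace ℝ (Fin (n + 1))) a + l| ∂μ'.meas := by
  have hm := measurable_nearest a l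
  set ν := mapW μ hm with hν
  have hcd : Continuous fun z : UnitSphere n × UnitSphere n => dist z.1 z.2 ^ 2 := by fun_prop
  have hbd : ∀ z : UnitSphere n × UnitSphere n, ‖dist z.1 z.2 ^ 2‖ ≤ 4 := fun z => by
    rw [Real.norm_of_nonneg (by positivity), ← dist_sq_add_dist_sq_neg z.1 z.2]
    linarith [sq_nonneg (dist z.1 (-z.2))]
  have hint : ∀ κ : WassersteinSpace 2 (UnitSphere n),
      ∫ x, (2 + 2 * l - 2 * |inner ℝ (x : EuclideanSpace ℝ (Fin (n + 1))) a + l|) ∂κ.meas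
        = 2 + 2 * l - 2 * ∫ x, |inner ℝ (x : EuclideanSpace ℝ (Fin (n + 1))) a + l| ∂κ.meas := by
    intro κ
    rw [integral_sub (integrable_const _) (integrable_of_continuous _ (by fun_prop)),
      integral_const, integral_const_mul]
    simp
  have hsupp : ∀ᵐ y ∂ν.meas, y = a ∨ y = -a := by
    refine (ae_map_iff hm.aemeasurable ?_).2 (Filter.Eventually.of_forall (nearest_eq_or_eq_neg a l))
    exact (measurableSet_singleton a).union (measurableSet_singleton (-a))
  have h1 : sqDist μ ν + l * ∫ y, dist y a ^ 2 ∂ν.meas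
      ≤ 2 + 2 * l - 2 * ∫ x, |inner ℝ (x : EuclideanSpace ℝ (Fin (n + 1))) a + l| ∂μ.meas := by
    rw [← hint, ← integral_congr_ae (Filter.Eventually.of_forall (cost_nearest a l)), integral_add,
      integral_const_mul, hν, integral_mapW μ hm (Continuous.measurable (by fun_prop))]
    · gcongr
      exact sqDist_mapW_le μ hm
    · exact Integrable.of_bound (hcd.measurable.comp
        (measurable_id.prodMk hm)).aestronglyMeasurable 4
        (Filter.Eventually.of_forall fun x => hbd (x, nearest a l x))
    · exact (Integrable.of_bound (hcd.measurable.comp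
        (hm.prodMk measurable_const)).aestronglyMeasurable 4
        (Filter.Eventually.of_forall fun x => hbd (nearest a l x, a))).const_mul l
  rw [h ν hsupp] at h1
  have h2 : 2 + 2 * l - 2 * ∫ x, |inner ℝ (x : EuclideanSpace ℝ (Fin (n + 1))) a + l| ∂μ'.meas
      ≤ sqDist μ' ν + l * ∫ y, dist y a ^ 2 ∂ν.meas := by
    refine le_of_forall_pos_le_add fun ε hε => ?_
    obtain ⟨π, hπ, hlt⟩ := exists_coupling_lt μ' ν hε
    have hmono : ∫ z, (2 + 2 * l - 2 * |inner ℝ (z.1 : EuclideanSpace ℝ (Fin (n + 1))) a + l|)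
          ∂(π : Measure (UnitSphere n × UnitSphere n))
        ≤ ∫ z, (dist z.1 z.2 ^ 2 + l * dist z.2 a ^ 2)
          ∂(π : Measure (UnitSphere n × UnitSphere n)) := by
      refine integral_mono_ae (integrable_of_continuous _ (by fun_prop))
        (integrable_of_continuous _ (by fun_prop)) ?_
      filter_upwards [ae_snd_of_mem hπ hsupp] with z hz using le_cost hz l z.1
    rw [integral_fst_of_mem hπ
        (f := fun x => 2 + 2 * l - 2 * |inner ℝ (x : EuclideanSpace ℝ (Fin (n + 1))) a + l|)
        (Continuous.measurable (by fun_prop)), hint,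
      integral_add (integrable_of_continuous _ (by fun_prop))
        (integrable_of_continuous _ (by fun_prop)), integral_const_mul,
      integral_snd_of_mem hπ (f := fun x => dist x a ^ 2) (Continuous.measurable (by fun_prop))]
      at hmono
    linarith
  linarith

end UnitSphere

/-! ### Laws on the line from integrals of `|x - t|` -/

section RealLine

open Filter Topology

/-- Difference quotients of `t ↦ |x - t|` from the right. -/
theorem tendsto_abs_sub_quotient (x k : ℝ) :
    Tendsto (fun j : ℕ => (|x - k| - |x - (k + ((j : ℝ) + 1)⁻¹)|) * ((j : ℝ) + 1)) atTop
      (𝓝 (1 - 2 * (Iic k).indicator (fun _ => (1 : ℝ)) x)) := by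
  -- The quotients are eventually equal to their limit: -1 for `x ≤ k`, and 1 once the step is
  -- shorter than `x - k`.
  refine tendsto_const_nhds.congr' ?_
  rcases le_or_gt x k with h | h
  · refine Eventually.of_forall fun j => ?_
    have hj : 0 < (j : ℝ) + 1 := by positivity
    have := inv_pos.2 hj
    beta_reduce
    rw [indicator_of_mem (mem_Iic.2 h), abs_of_nonpos (sub_nonpos.2 h),
      abs_of_nonpos (by linarith : x - (k + ((j : ℝ) + 1)⁻¹) ≤ 0)]
    field_simp
    ring
  · have ht : Tendsto (fun j : ℕ => ((j : ℝ) + 1)⁻¹) atTop (𝓝 0) := by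
      simpa using tendsto_one_div_add_atTop_nhds_zero_nat (𝕜 := ℝ)
    filter_upwards [ht.eventually (gt_mem_nhds (sub_pos.2 h))] with j hlt
    have hj : 0 < (j : ℝ) + 1 := by positivity
    rw [indicator_of_notMem (by simpa using h), abs_of_pos (sub_pos.2 h),
      abs_of_pos (by linarith : 0 < x - (k + ((j : ℝ) + 1)⁻¹))]
    field_simp
    ring

/-- A probability measure on the line is determined by its integrals of the functions `|x - t|`. -/
theorem MeasureTheory.Measure.ext_of_integral_abs_sub {μ ν : Measure ℝ} [IsProbabilityMeasure μ]
    [IsProbabilityMeasure ν] (hμ : ∀ t, Integrable (fun x => |x - t|) μ)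
    (hν : ∀ t, Integrable (fun x => |x - t|) ν)
    (h : ∀ t, ∫ x, |x - t| ∂μ = ∫ x, |x - t| ∂ν) : μ = ν := by
  have key : ∀ (κ : Measure ℝ) [IsProbabilityMeasure κ], (∀ t, Integrable (fun x => |x - t|) κ) →
      ∀ k : ℝ, Tendsto (fun j : ℕ => (∫ x, |x - k| ∂κ - ∫ x, |x - (k + ((j : ℝ) + 1)⁻¹)| ∂κ)
        * ((j : ℝ) + 1)) atTop (𝓝 (1 - 2 * κ.real (Iic k))) := by
    intro κ _ hκ k
    have hlim : 1 - 2 * κ.real (Iic k)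
        = ∫ x, (1 - 2 * (Iic k).indicator (fun _ => (1 : ℝ)) x) ∂κ := by
      rw [integral_sub (integrable_const _)
        (((integrable_const _).indicator measurableSet_Iic).const_mul 2), integral_const_mul,
        integral_indicator measurableSet_Iic]
      simp
    rw [hlim]
    refine (tendsto_integral_of_dominated_convergence
      (F := fun (j : ℕ) x => (|x - k| - |x - (k + ((j : ℝ) + 1)⁻¹)|) * ((j : ℝ) + 1))
      (fun _ => 1) (fun j => ?_) (integrable_const _) (fun j => ?_) ?_).congr fun j => ?_
    · exact (Continuous.measurable (by fun_prop)).aestronglyMeasurable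
    · refine Eventually.of_forall fun x => ?_
      have hj : 0 < (j : ℝ) + 1 := by positivity
      have h1 := abs_abs_sub_abs_le_abs_sub (x - k) (x - (k + ((j : ℝ) + 1)⁻¹))
      have h2 : x - k - (x - (k + ((j : ℝ) + 1)⁻¹)) = ((j : ℝ) + 1)⁻¹ := by ring
      rw [h2, abs_of_pos (inv_pos.2 hj)] at h1
      rw [norm_mul, Real.norm_eq_abs, Real.norm_of_nonneg hj.le]
      calc _ ≤ ((j : ℝ) + 1)⁻¹ * ((j : ℝ) + 1) := by gcongr
        _ = 1 := inv_mul_cancel₀ hj.ne'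
    · exact Eventually.of_forall fun x => tendsto_abs_sub_quotient x k
    · rw [integral_mul_const, integral_sub (hκ _) (hκ _)]
  refine Measure.ext_of_Iic μ ν fun k => ?_
  have h1 := key μ hμ k
  simp only [h] at h1
  have h2 := tendsto_nhds_unique h1 (key ν hν k)
  rw [← measureReal_eq_measureReal_iff]
  linarith

end RealLine

/-! ### Reconstruction of the measure and conclusion -/

namespace UnitSphere

open WassersteinSpace

variable {n : ℕ}

/-- A probability measure on the sphere is determined by the integrals of `|⟪x, a⟫ + l|`. -/
theorem eq_of_integral_abs_inner_add_eq {μ ν : WassersteinSpace 2 (UnitSphere n)}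
    (h : ∀ (a : UnitSphere n) (l : ℝ),
      ∫ x, |inner ℝ (x : EuclideanSpace ℝ (Fin (n + 1))) a + l| ∂μ.meas
        = ∫ x, |inner ℝ (x : EuclideanSpace ℝ (Fin (n + 1))) a + l| ∂ν.meas) : μ = ν := by
  have hm : ∀ a : UnitSphere n,
      Measurable fun x : UnitSphere n => inner ℝ (x : EuclideanSpace ℝ (Fin (n + 1))) a :=
    fun a => Continuous.measurable (by fun_prop)
  have hma : ∀ t : ℝ, Measurable fun x : ℝ => |x - t| :=
    fun t => Continuous.measurable (by fun_prop)
  have hlaw : ∀ a : UnitSphere n,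
      μ.meas.map (fun x : UnitSphere n => inner ℝ (x : EuclideanSpace ℝ (Fin (n + 1))) a)
        = ν.meas.map fun x : UnitSphere n => inner ℝ (x : EuclideanSpace ℝ (Fin (n + 1))) a := by
    intro a
    have hp : ∀ κ : WassersteinSpace 2 (UnitSphere n), IsProbabilityMeasure
        (κ.meas.map fun x : UnitSphere n => inner ℝ (x : EuclideanSpace ℝ (Fin (n + 1))) a) :=
      fun κ => Measure.isProbabilityMeasure_map (hm a).aemeasurable
    have := hp μ
    have := hp ν
    have hi : ∀ (κ : WassersteinSpace 2 (UnitSphere n)) (t : ℝ), Integrable (fun x => |x - t|)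
        (κ.meas.map fun x : UnitSphere n => inner ℝ (x : EuclideanSpace ℝ (Fin (n + 1))) a) := fun κ t =>
      (integrable_map_measure (hma t).aestronglyMeasurable (hm a).aemeasurable).2
        (integrable_of_continuous _ (by fun_prop))
    refine Measure.ext_of_integral_abs_sub (hi μ) (hi ν) fun t => ?_
    rw [integral_map (hm a).aemeasurable (hma t).aestronglyMeasurable,
      integral_map (hm a).aemeasurable (hma t).aestronglyMeasurable]
    simpa only [sub_eq_add_neg] using h a (-t)
  have hemb : MeasurableEmbedding
      (Subtype.val : UnitSphere n → EuclideanSpace ℝ (Fin (n + 1))) :=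
    MeasurableEmbedding.subtype_coe Metric.isClosed_sphere.measurableSet
  refine meas_injective (hemb.map_injective ?_)
  have hpv : ∀ κ : WassersteinSpace 2 (UnitSphere n), IsProbabilityMeasure
      (κ.meas.map (Subtype.val : UnitSphere n → EuclideanSpace ℝ (Fin (n + 1)))) :=
    fun κ => Measure.isProbabilityMeasure_map hemb.measurable.aemeasurable
  have := hpv μ
  have := hpv ν
  refine Measure.ext_of_charFun (funext fun v => ?_)
  rcases eq_or_ne v 0 with rfl | hv
  · simp
  have hv0 : ‖v‖ ≠ 0 := norm_ne_zero_iff.2 hv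
  let a : UnitSphere n := ⟨‖v‖⁻¹ • v, by
    rw [mem_sphere_zero_iff_norm, norm_smul, norm_inv, norm_norm, inv_mul_cancel₀ hv0]⟩
  have hva : ∀ x : EuclideanSpace ℝ (Fin (n + 1)), inner ℝ x v = ‖v‖ * inner ℝ x a := fun x => by
    rw [real_inner_smul_right, mul_inv_cancel_left₀ hv0]
  -- Cramér–Wold: the characteristic function at `v` depends only on the law of the projection onto
  -- the direction of `v`.
  have hchar : ∀ κ : WassersteinSpace 2 (UnitSphere n),
      charFun (κ.meas.map (Subtype.val : UnitSphere n → EuclideanSpace ℝ (Fin (n + 1)))) v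
        = charFun (κ.meas.map fun x : UnitSphere n => inner ℝ (x : EuclideanSpace ℝ (Fin (n + 1))) a) ‖v‖ := by
    intro κ
    rw [charFun_apply, charFun_apply_real, integral_map hemb.measurable.aemeasurable
      (Continuous.measurable (by fun_prop)).aestronglyMeasurable,
      integral_map (hm a).aemeasurable (Continuous.measurable (by fun_prop)).aestronglyMeasurable]
    refine integral_congr_ae (Filter.Eventually.of_forall fun x => ?_)
    simp only [hva]
    push_cast
    rfl
  rw [hchar, hchar, hlaw]

/-- A distance preserving map of the Wasserstein space that fixes all Dirac masses is the
identity. -/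
theorem eq_self_of_fixes_diracW
    {Φ : WassersteinSpace 2 (UnitSphere n) → WassersteinSpace 2 (UnitSphere n)}
    (hΦ : ∀ μ ν, sqDist (Φ μ) (Φ ν) = sqDist μ ν) (hfix : ∀ y, Φ (diracW y) = diracW y)
    (μ : WassersteinSpace 2 (UnitSphere n)) : Φ μ = μ := by
  have h : ∀ (a : UnitSphere n) (ν : WassersteinSpace 2 (UnitSphere n)),
      (∀ᵐ y ∂ν.meas, y = a ∨ y = -a) → sqDist (Φ μ) ν = sqDist μ ν := fun a ν hν => by
    rw [← hΦ μ ν, map_eq_of_ae_antipodal hΦ hfix hν]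
  exact eq_of_integral_abs_inner_add_eq fun a l => le_antisymm
    (integral_abs_le_of_sqDist_eq (h a) l)
    (integral_abs_le_of_sqDist_eq (fun ν hν => (h a ν hν).symm) l)

end UnitSphere

theorem theorem1p1 (n : ℕ)
    (Ψ : WassersteinSpace 2 (UnitSphere n) → WassersteinSpace 2 (UnitSphere n))
    (hΨ : WassersteinSpace.IsIsometry Ψ) :
    ∃ ψ : UnitSphere n ≃ᵢ UnitSphere n, Ψ = WassersteinSpace.push ψ := by
  have hsq : ∀ μ ν, WassersteinSpace.sqDist (Ψ μ) (Ψ ν) = WassersteinSpace.sqDist μ ν :=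
    fun μ ν => WassersteinSpace.sqDist_eq_of_wDist_eq (hΨ.wDist_eq μ ν)
  obtain ⟨ψ, hψ⟩ := UnitSphere.exists_isometryEquiv hsq hΨ.surjective
  refine ⟨ψ, funext fun μ => ?_⟩
  have hid := UnitSphere.eq_self_of_fixes_diracW (Φ := fun μ => WassersteinSpace.push ψ.symm (Ψ μ))
    (fun μ ν => by rw [WassersteinSpace.sqDist_push, hsq])
    (fun y => by rw [hψ, WassersteinSpace.push_diracW, ψ.symm_apply_apply]) μ
  calc Ψ μ = WassersteinSpace.push ψ (WassersteinSpace.push ψ.symm (Ψ μ)) :=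
        (WassersteinSpace.push_push_symm ψ (Ψ μ)).symm
    _ = WassersteinSpace.push ψ μ := congrArg _ hid
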